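/- Let $p \ge 1$ be real and $n \ge 0$ an integer. Let $\mathcal{P}_p(\mathbb{R}^n)$ be the set of Borel probability measures $\mu$ on $\mathbb{R}^n$ with $\int \|x\|_p^p \, d\mu(x) < \infty$, where $\|x\|_p = (\sum_i |x_i|^p)^{1/p}$. For $\mu, \nu \in \mathcal{P}_p(\mathbb{R}^n)$ let $\Gamma(\mu,\nu)$ be the set of couplings of $\mu$ and $\nu$, that is, of measures on $\mathbb{R}^n \times \mathbb{R}^n$ with first marginal $\mu$ and second marginal $\nu$, and put $$RW_p(\mu,\nu) = \Big( \inf_{s \in \mathbb{R}^n} \; \inf_{\gamma \in \Gamma(\mu,\nu)} \int \|x + s - y\|_p^p \, d\gamma(x,y) \Big)^{1/p}.$$ Write $\mu \sim \nu$ if $\nu$ is the image of $\mu$ under a translation $x \mapsto x + s$ with $s \in \mathbb{R}^n$; this is an equivalence relation on $\mathcal{P}_p(\mathbb{R}^n)$. Then: 1. $RW_p$ is finite, depends only on the classes $[\mu]$ and $[\nu]$, and $([\mu],[\nu]) \mapsto RW_p(\mu,\nu)$ is a metric on the quotient set $\mathcal{P}_p(\mathbb{R}^n)/\sim$. 2.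 $RW_p$ is a pseudometric on $\mathcal{P}_p(\mathbb{R}^n)$. 3. If $n \ge 1$, then $RW_p$ is not a metric on $\mathcal{P}_p(\mathbb{R}^n)$: there are $\mu \ne \nu$ in $\mathcal{P}_p(\mathbb{R}^n)$ with $RW_p(\mu,\nu) = 0$. -/

import Mathlib

open MeasureTheory
open scoped ENNReal

namespace RelTransWasserstein

/-- The `p`-norm on `ℝⁿ`, namely `(∑ i, |x i| ^ p) ^ (1 / p)` for a real exponent `p ≥ 1`. -/
noncomputable def pNorm (p : ℝ) {n : ℕ} (x : Fin n → ℝ) : ℝ :=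
  ‖WithLp.toLp (ENNReal.ofReal p) x‖

/-- `𝒫_p(ℝⁿ)`: the Borel probability measures on `ℝⁿ` with finite moment of order `p`. -/
def PP (p : ℝ) (n : ℕ) : Type :=
  {μ : Measure (Fin n → ℝ) //
    IsProbabilityMeasure μ ∧ ∫⁻ x, ENNReal.ofReal (pNorm p x ^ p) ∂μ < ∞}

/-- The transport plans between `μ` and `ν`: measures on `ℝⁿ × ℝⁿ` with marginals `μ` and `ν`.
If `μ` and `ν` lie in `𝒫_p(ℝⁿ)`, a plan automatically is a probability measure with finite
moment of order `p`. -/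
def couplings {n : ℕ} (μ ν : Measure (Fin n → ℝ)) :
    Set (Measure ((Fin n → ℝ) × (Fin n → ℝ))) :=
  {γ | γ.map Prod.fst = μ ∧ γ.map Prod.snd = ν}

/-- The value of the relative translation optimal transport problem: the infimum, over all
translations `s` of the source and all transport plans `γ`, of the cost
`∫ ‖x + s - y‖_p ^ p dγ(x, y)`. -/
noncomputable def ROT (p : ℝ) {n : ℕ} (μ ν : Measure (Fin n → ℝ)) : ℝ≥0∞ :=
  ⨅ s : Fin n → ℝ, ⨅ γ ∈ couplings μ ν,
    ∫⁻ z, ENNReal.ofReal (pNorm p (z.1 + s - z.2) ^ p) ∂γ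

/-- `RW_p(μ, ν) = ROT(μ, ν, p) ^ (1 / p)`, a priori with values in `[0, ∞]`. -/
noncomputable def RW (p : ℝ) {n : ℕ} (μ ν : PP p n) : ℝ≥0∞ :=
  ROT p μ.1 ν.1 ^ (1 / p)

/-- The translation relation on `𝒫_p(ℝⁿ)`: `μ ∼ ν` when `ν` is the image of `μ` under some
translation `x ↦ x + s`. -/
def transSetoid (p : ℝ) (n : ℕ) : Setoid (PP p n) where
  r μ ν := ∃ s : Fin n → ℝ, ν.1 = μ.1.map (fun x => x + s)
  iseqv :=
    { refl := fun μ => ⟨0, by simp⟩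
      symm := by
        rintro μ ν ⟨s, hs⟩
        refine ⟨-s, ?_⟩
        rw [hs, Measure.map_map (measurable_add_const _) (measurable_add_const _)]
        have h : (fun x : Fin n → ℝ => x + -s) ∘ (fun x => x + s) = id := by
          funext x; simp
        rw [h, Measure.map_id]
      trans := by
        rintro μ ν ρ ⟨s, hs⟩ ⟨t, ht⟩
        refine ⟨s + t, ?_⟩
        rw [ht, hs, Measure.map_map (measurable_add_const _) (measurable_add_const _)]
        congr 1
        funext x
        simp [add_assoc] }

end RelTransWasserstein

namespace RelTransWasserstein

open Filter Topology Metric ProbabilityTheory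

section pNorm

variable {p : ℝ} {n : ℕ}

/-! After the `p`-th root, `RW` is an infimum of `L^p` sizes of `x + s - y` (`RW_eq_iInf`), so
Minkowski applies. The triangle inequality glues plans along the common marginal and adds the
shifts; since `RW` vanishes on translates, it descends to classes. Separation needs no optimal plan.
If `RW` is zero, near-optimal shifts are bounded by the moments of the two measures, so a
subsequence converges to some `t`; the cost at the fixed shift `t` is then arbitrarily small, and
Markov's inequality makes the Lévy–Prokhorov distance from the translate of `μ` to `ν` zero. -/

lemma pNorm_nonneg (hp : 1 ≤ p) (x : Fin n → ℝ) : 0 ≤ pNorm p x := by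
  have : Fact (1 ≤ ENNReal.ofReal p) := ⟨by simpa using hp⟩
  exact norm_nonneg (WithLp.toLp (ENNReal.ofReal p) x)

lemma pNorm_add_le (hp : 1 ≤ p) (x y : Fin n → ℝ) : pNorm p (x + y) ≤ pNorm p x + pNorm p y := by
  have : Fact (1 ≤ ENNReal.ofReal p) := ⟨by simpa using hp⟩
  exact norm_add_le (WithLp.toLp (ENNReal.ofReal p) x) (WithLp.toLp (ENNReal.ofReal p) y)

lemma pNorm_neg (hp : 1 ≤ p) (x : Fin n → ℝ) : pNorm p (-x) = pNorm p x := by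
  have : Fact (1 ≤ ENNReal.ofReal p) := ⟨by simpa using hp⟩
  exact norm_neg (WithLp.toLp (ENNReal.ofReal p) x)

lemma pNorm_zero (hp : 1 ≤ p) : pNorm p (0 : Fin n → ℝ) = 0 := by
  have : Fact (1 ≤ ENNReal.ofReal p) := ⟨by simpa using hp⟩
  exact norm_zero (E := PiLp (ENNReal.ofReal p) fun _ : Fin n => ℝ)

lemma continuous_pNorm (hp : 1 ≤ p) : Continuous (pNorm p : (Fin n → ℝ) → ℝ) := by
  have : Fact (1 ≤ ENNReal.ofReal p) := ⟨by simpa using hp⟩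
  exact (continuous_norm (E := PiLp (ENNReal.ofReal p) fun _ : Fin n => ℝ)).comp
    (PiLp.continuous_toLp (ENNReal.ofReal p) fun _ : Fin n => ℝ)

lemma norm_le_pNorm (hp : 1 ≤ p) (x : Fin n → ℝ) : ‖x‖ ≤ pNorm p x := by
  have : Fact (1 ≤ ENNReal.ofReal p) := ⟨by simpa using hp⟩
  exact (pi_norm_le_iff_of_nonneg (pNorm_nonneg hp x)).2 fun i =>
    PiLp.norm_apply_le (WithLp.toLp (ENNReal.ofReal p) x) i

lemma ofReal_pNorm_rpow (hp : 1 ≤ p) (x : Fin n → ℝ) :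
    ENNReal.ofReal (pNorm p x ^ p) = ENNReal.ofReal (pNorm p x) ^ p :=
  (ENNReal.ofReal_rpow_of_nonneg (pNorm_nonneg hp x) (by linarith)).symm

end pNorm

/-- The `L^p` size `(∫ ‖f‖_p ^ p dμ) ^ (1 / p)` of a map with values in `ℝⁿ`. -/
noncomputable def lpSize (p : ℝ) {n : ℕ} {Ω : Type*} [MeasurableSpace Ω] (f : Ω → Fin n → ℝ)
    (μ : Measure Ω) : ℝ≥0∞ :=
  (∫⁻ ω, ENNReal.ofReal (pNorm p (f ω) ^ p) ∂μ) ^ (1 / p)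

section lpSize

variable {p : ℝ} {n : ℕ} {Ω Ω' : Type*} [MeasurableSpace Ω] [MeasurableSpace Ω'] {μ : Measure Ω}

lemma measurable_ofReal_pNorm_rpow (hp : 1 ≤ p) :
    Measurable fun x : Fin n → ℝ => ENNReal.ofReal (pNorm p x ^ p) :=
  ((continuous_pNorm hp).measurable.pow_const p).ennreal_ofReal

lemma lpSize_add_le (hp : 1 ≤ p) {f g : Ω → Fin n → ℝ} (hf : Measurable f) (hg : Measurable g) :
    lpSize p (fun ω => f ω + g ω) μ ≤ lpSize p f μ + lpSize p g μ := by
  have hm := (continuous_pNorm (n := n) hp).measurable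
  simp only [lpSize, ofReal_pNorm_rpow hp]
  refine le_trans ?_ (ENNReal.lintegral_Lp_add_le (μ := μ)
    (hm.comp hf).ennreal_ofReal.aemeasurable (hm.comp hg).ennreal_ofReal.aemeasurable hp)
  have hp0 : 0 ≤ p := by linarith
  gcongr with ω
  exact (ENNReal.ofReal_le_ofReal (pNorm_add_le hp _ _)).trans ENNReal.ofReal_add_le

lemma lpSize_neg (hp : 1 ≤ p) (f : Ω → Fin n → ℝ) :
    lpSize p (fun ω => -f ω) μ = lpSize p f μ := by
  simp only [lpSize, pNorm_neg hp]

lemma lpSize_const (hp : 1 ≤ p) [IsProbabilityMeasure μ] (s : Fin n → ℝ) :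
    lpSize p (fun _ => s) μ = ENNReal.ofReal (pNorm p s) := by
  simp only [lpSize, ofReal_pNorm_rpow hp, lintegral_const, measure_univ, mul_one, one_div]
  exact ENNReal.rpow_rpow_inv (by linarith) _

lemma lpSize_map (hp : 1 ≤ p) {g : Ω → Ω'} (hg : Measurable g) {f : Ω' → Fin n → ℝ}
    (hf : Measurable f) : lpSize p f (μ.map g) = lpSize p (fun ω => f (g ω)) μ := by
  exact congrArg (· ^ (1 / p)) (lintegral_map ((measurable_ofReal_pNorm_rpow hp).comp hf) hg)

end lpSize

section couplings

variable {n : ℕ} {μ ν ρ : Measure (Fin n → ℝ)}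

lemma isProbabilityMeasure_of_mem_couplings [IsProbabilityMeasure μ]
    {γ : Measure ((Fin n → ℝ) × (Fin n → ℝ))} (hγ : γ ∈ couplings μ ν) :
    IsProbabilityMeasure γ := by
  constructor
  rw [← measure_univ (μ := μ), ← hγ.1, Measure.map_apply measurable_fst .univ, Set.preimage_univ]

/-- Gluing: two plans with a common marginal are the two-dimensional marginals of one measure. -/
lemma exists_gluing [IsProbabilityMeasure μ] [IsProbabilityMeasure ν]
    {γ₁ γ₂ : Measure ((Fin n → ℝ) × (Fin n → ℝ))} (h₁ : γ₁ ∈ couplings μ ν)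
    (h₂ : γ₂ ∈ couplings ν ρ) :
    ∃ π : Measure ((Fin n → ℝ) × (Fin n → ℝ) × (Fin n → ℝ)),
      π.map (fun w => (w.2.1, w.1)) = γ₁ ∧ π.map (fun w => (w.1, w.2.2)) = γ₂ := by
  have := isProbabilityMeasure_of_mem_couplings h₁
  have := isProbabilityMeasure_of_mem_couplings h₂
  have : IsProbabilityMeasure (γ₁.map Prod.swap) :=
    Measure.isProbabilityMeasure_map measurable_swap.aemeasurable
  have hν₁ : (γ₁.map Prod.swap).fst = ν := by
    rw [Measure.fst, Measure.map_map measurable_fst measurable_swap]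
    exact h₁.2
  have hν₂ : γ₂.fst = ν := h₂.1
  -- Disintegrate both plans over `ν` and make the outer coordinates conditionally independent given
  -- the middle one, which is stored first.
  let κ₁ := (γ₁.map Prod.swap).condKernel
  let κ₂ := γ₂.condKernel
  have e₁ : ν ⊗ₘ κ₁ = γ₁.map Prod.swap := by
    rw [← hν₁]; exact Measure.disintegrate _ _
  have e₂ : ν ⊗ₘ κ₂ = γ₂ := by
    rw [← hν₂]; exact Measure.disintegrate _ _
  refine ⟨ν ⊗ₘ (κ₁ ×ₖ κ₂), ?_, ?_⟩
  · have h : (ν ⊗ₘ (κ₁ ×ₖ κ₂)).map (Prod.map id Prod.fst) = γ₁.map Prod.swap := by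
      rw [← Measure.compProd_map measurable_fst, ← Kernel.fst_eq, Kernel.fst_prod, e₁]
    have h' := congrArg (Measure.map Prod.swap) h
    rw [Measure.map_map measurable_swap measurable_swap, Prod.swap_swap_eq, Measure.map_id,
      Measure.map_map measurable_swap (measurable_id.prodMap measurable_fst)] at h'
    exact h'
  · have h : (ν ⊗ₘ (κ₁ ×ₖ κ₂)).map (Prod.map id Prod.snd) = γ₂ := by
      rw [← Measure.compProd_map measurable_snd, ← Kernel.snd_eq, Kernel.snd_prod, e₂]
    exact h

end couplings

section RW

variable {p : ℝ} {n : ℕ}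

instance (μ : PP p n) : IsProbabilityMeasure μ.1 := μ.2.1

/-- The power `1 / p` is an order isomorphism of `[0, ∞]`, so it commutes with infima. -/
lemma RW_eq_iInf (hp : 1 ≤ p) (μ ν : PP p n) :
    RW p μ ν = ⨅ s : Fin n → ℝ, ⨅ γ ∈ couplings μ.1 ν.1, lpSize p (fun z => z.1 + s - z.2) γ := by
  have h : 0 < 1 / p := by positivity
  have key := fun x : ℝ≥0∞ => (ENNReal.orderIsoRpow_apply (1 / p) h x)
  simp only [RW, ROT, lpSize]
  rw [← key]
  simp only [OrderIso.map_iInf]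
  rfl

lemma RW_le (hp : 1 ≤ p) {μ ν : PP p n} (s : Fin n → ℝ)
    {γ : Measure ((Fin n → ℝ) × (Fin n → ℝ))} (hγ : γ ∈ couplings μ.1 ν.1) :
    RW p μ ν ≤ lpSize p (fun z => z.1 + s - z.2) γ := by
  rw [RW_eq_iInf hp]
  exact iInf_le_of_le s (iInf₂_le γ hγ)

lemma lpSize_id_ne_top (hp : 1 ≤ p) (μ : PP p n) : lpSize p (fun x => x) μ.1 ≠ ∞ :=
  ENNReal.rpow_ne_top_of_nonneg (by positivity) μ.2.2.ne

lemma lpSize_fst (hp : 1 ≤ p) {μ ν : Measure (Fin n → ℝ)}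
    {γ : Measure ((Fin n → ℝ) × (Fin n → ℝ))} (hγ : γ ∈ couplings μ ν) :
    lpSize p (fun z => z.1) γ = lpSize p (fun x => x) μ := by
  rw [← hγ.1, lpSize_map hp measurable_fst measurable_id']

lemma lpSize_snd (hp : 1 ≤ p) {μ ν : Measure (Fin n → ℝ)}
    {γ : Measure ((Fin n → ℝ) × (Fin n → ℝ))} (hγ : γ ∈ couplings μ ν) :
    lpSize p (fun z => z.2) γ = lpSize p (fun x => x) ν := by
  rw [← hγ.2, lpSize_map hp measurable_snd measurable_id']

lemma RW_ne_top (hp : 1 ≤ p) (μ ν : PP p n) : RW p μ ν ≠ ∞ := by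
  have hγ : μ.1.prod ν.1 ∈ couplings μ.1 ν.1 := by
    exact ⟨Measure.fst_prod, Measure.snd_prod⟩
  refine ne_top_of_le_ne_top ?_ (RW_le hp 0 hγ)
  simp only [add_zero, sub_eq_add_neg]
  refine ne_top_of_le_ne_top ?_ (lpSize_add_le hp measurable_fst measurable_snd.neg)
  rw [lpSize_neg hp, lpSize_fst hp hγ, lpSize_snd hp hγ]
  exact ENNReal.add_ne_top.2 ⟨lpSize_id_ne_top hp μ, lpSize_id_ne_top hp ν⟩

lemma RW_le_swap (hp : 1 ≤ p) (μ ν : PP p n) : RW p μ ν ≤ RW p ν μ := by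
  rw [RW_eq_iInf hp ν μ]
  refine le_iInf fun s => le_iInf₂ fun γ hγ => ?_
  have h : γ.map Prod.swap ∈ couplings μ.1 ν.1 := by
    constructor
    · rw [Measure.map_map measurable_fst measurable_swap]; exact hγ.2
    · rw [Measure.map_map measurable_snd measurable_swap]; exact hγ.1
  refine (RW_le hp (-s) h).trans_eq ?_
  rw [lpSize_map hp measurable_swap (by fun_prop), ← lpSize_neg hp]
  congr 1
  funext z
  simp only [Prod.fst_swap, Prod.snd_swap]
  abel

lemma RW_comm (hp : 1 ≤ p) (μ ν : PP p n) : RW p μ ν = RW p ν μ :=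
  le_antisymm (RW_le_swap hp μ ν) (RW_le_swap hp ν μ)

lemma RW_triangle (hp : 1 ≤ p) (μ ν ρ : PP p n) : RW p μ ρ ≤ RW p μ ν + RW p ν ρ := by
  rw [RW_eq_iInf hp μ ν, RW_eq_iInf hp ν ρ]
  simp only [ENNReal.iInf_add, ENNReal.add_iInf]
  refine le_iInf fun t => le_iInf₂ fun γ₂ h₂ => le_iInf fun s => le_iInf₂ fun γ₁ h₁ => ?_
  obtain ⟨π, hπ₁, hπ₂⟩ := exists_gluing h₁ h₂
  have hγ : π.map (fun w => (w.2.1, w.2.2)) ∈ couplings μ.1 ρ.1 := by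
    constructor
    · rw [← h₁.1, ← hπ₁, Measure.map_map (by fun_prop) (by fun_prop),
        Measure.map_map (by fun_prop) (by fun_prop)]
      rfl
    · rw [← h₂.2, ← hπ₂, Measure.map_map (by fun_prop) (by fun_prop),
        Measure.map_map (by fun_prop) (by fun_prop)]
      rfl
  refine (RW_le hp (s + t) hγ).trans ?_
  rw [← hπ₁, ← hπ₂, lpSize_map hp (by fun_prop) (by fun_prop),
    lpSize_map hp (by fun_prop) (by fun_prop), lpSize_map hp (by fun_prop) (by fun_prop)]
  -- With `w = (y, x, z)`: `x + (s + t) - z = (x + s - y) + (y + t - z)`.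
  refine le_trans (le_of_eq ?_) (lpSize_add_le hp (by fun_prop) (by fun_prop))
  congr 1
  funext w
  simp only
  abel

lemma RW_eq_zero_of_map (hp : 1 ≤ p) {μ ν : PP p n} {s : Fin n → ℝ}
    (h : ν.1 = μ.1.map (fun x => x + s)) : RW p μ ν = 0 := by
  have hγ : μ.1.map (fun x => (x, x + s)) ∈ couplings μ.1 ν.1 := by
    constructor
    · rw [Measure.map_map (by fun_prop) (by fun_prop)]; exact Measure.map_id
    · rw [Measure.map_map (by fun_prop) (by fun_prop), h]; rfl
  refine le_antisymm ((RW_le hp s hγ).trans_eq ?_) zero_le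
  rw [lpSize_map hp (by fun_prop) (by fun_prop)]
  simp only [sub_self]
  rw [lpSize_const hp, pNorm_zero hp, ENNReal.ofReal_zero]

lemma map_add_eq_of_forall_exists_lpSize_lt (hp : 1 ≤ p) {μ ν : Measure (Fin n → ℝ)}
    [IsProbabilityMeasure μ] [IsProbabilityMeasure ν] (s : Fin n → ℝ)
    (h : ∀ δ : ℝ≥0∞, 0 < δ → ∃ γ ∈ couplings μ ν, lpSize p (fun z => z.1 + s - z.2) γ < δ) :
    ν = μ.map (fun x => x + s) := by
  have : IsProbabilityMeasure (μ.map (fun x => x + s)) :=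
    Measure.isProbabilityMeasure_map (by fun_prop)
  have hp0 : 0 < p := by linarith
  have hLP : levyProkhorovEDist (μ.map (fun x => x + s)) ν = 0 := by
    refine le_antisymm (levyProkhorovEDist_le_of_forall_le _ _ 0 fun ε B hε hε' hB => ?_) zero_le
    have hεp : ε ^ p ≠ 0 := (ENNReal.rpow_pos hε hε'.ne).ne'
    have hεp' : ε ^ p ≠ ∞ := ENNReal.rpow_ne_top_of_nonneg hp0.le hε'.ne
    -- Chosen so that Markov at level `ε ^ p` gives mass at most `ε` to displacements of size at
    -- least `ε`.
    obtain ⟨γ, hγ, hlt⟩ := h ((ε ^ p * ε) ^ (1 / p))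
      (ENNReal.rpow_pos (ENNReal.mul_pos hεp hε.ne') (ENNReal.mul_ne_top hεp' hε'.ne))
    have hint := ((ENNReal.rpow_lt_rpow_iff (by positivity)).1 hlt).le
    have hmk := (mul_meas_ge_le_lintegral (μ := γ)
      ((measurable_ofReal_pNorm_rpow hp).comp
        (show Measurable fun z : (Fin n → ℝ) × (Fin n → ℝ) => z.1 + s - z.2 by fun_prop))
      (ε ^ p)).trans hint
    have hmk' := (ENNReal.mul_le_mul_iff_right hεp hεp').1 hmk
    rw [Measure.map_apply (by fun_prop) hB, ← hγ.1, ← hγ.2,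
      Measure.map_apply measurable_fst (measurable_add_const s hB),
      Measure.map_apply measurable_snd isOpen_thickening.measurableSet]
    refine le_trans ?_ (add_le_add_right hmk' _)
    refine le_trans (measure_mono fun z hz => ?_) (measure_union_le _ _)
    -- Off the Markov event, `x + s ∈ B` puts `y` in the `ε`-thickening of `B`; the ambient sup
    -- distance is at most the `p`-norm.
    by_contra hcon
    simp only [Set.mem_union, Set.mem_preimage, Set.mem_ofPred_eq, not_or, Function.comp,
      not_le] at hcon
    rw [ofReal_pNorm_rpow hp, ENNReal.rpow_lt_rpow_iff hp0,
      ENNReal.ofReal_lt_iff_lt_toReal (pNorm_nonneg hp _) hε'.ne] at hcon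
    refine hcon.1 (mem_thickening_iff.2 ⟨z.1 + s, hz, ?_⟩)
    rw [dist_comm, dist_eq_norm]
    exact (norm_le_pNorm hp _).trans_lt hcon.2
  refine (ext_of_generate_finite _ (BorelSpace.measurable_eq.trans borel_eq_generateFrom_isClosed)
    isPiSystem_isClosed (fun F hF => ?_) (by simp)).symm
  exact measure_eq_measure_of_levyProkhorovEDist_eq_zero_of_isClosed hLP hF
    ⟨1, one_pos, measure_ne_top _ _⟩ ⟨1, one_pos, measure_ne_top _ _⟩

lemma exists_map_of_RW_eq_zero (hp : 1 ≤ p) {μ ν : PP p n} (h : RW p μ ν = 0) :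
    ∃ s : Fin n → ℝ, ν.1 = μ.1.map (fun x => x + s) := by
  have hex : ∀ δ : ℝ≥0∞, 0 < δ → ∃ s : Fin n → ℝ, ∃ γ ∈ couplings μ.1 ν.1,
      lpSize p (fun z => z.1 + s - z.2) γ < δ := by
    intro δ hδ
    rw [← h, RW_eq_iInf hp] at hδ
    simpa only [iInf_lt_iff, exists_prop] using hδ
  choose s γ hγ hlt using fun k : ℕ => hex (((k : ℝ≥0∞) + 1)⁻¹) (by simp)
  -- From `s = (x + s - y) + (y - x)`: the first term has size at most 1, the second is controlled
  -- by the moments.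
  set M : ℝ≥0∞ := 1 + (lpSize p (fun x => x) ν.1 + lpSize p (fun x => x) μ.1)
  have hM : M ≠ ∞ := by
    simp [M, lpSize_id_ne_top hp]
  have hbound : ∀ k, s k ∈ closedBall (0 : Fin n → ℝ) M.toReal := by
    intro k
    have := isProbabilityMeasure_of_mem_couplings (hγ k)
    rw [mem_closedBall_zero_iff]
    refine (norm_le_pNorm hp _).trans ((ENNReal.ofReal_le_iff_le_toReal hM).1 ?_)
    simp only [M]
    rw [← lpSize_const hp (μ := γ k) (s k), ← lpSize_snd hp (hγ k), ← lpSize_fst hp (hγ k),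
      ← lpSize_neg hp (fun z : (Fin n → ℝ) × (Fin n → ℝ) => z.1)]
    calc lpSize p (fun _ => s k) (γ k)
        = lpSize p (fun z => (z.1 + s k - z.2) + (z.2 + -z.1)) (γ k) := by
          congr 1; funext z; abel
      _ ≤ lpSize p (fun z => z.1 + s k - z.2) (γ k) + lpSize p (fun z => z.2 + -z.1) (γ k) :=
          lpSize_add_le hp (by fun_prop) (by fun_prop)
      _ ≤ _ := add_le_add ((hlt k).le.trans (by simp))
          (lpSize_add_le hp (by fun_prop) (by fun_prop))
  obtain ⟨t, -, φ, hφ, hlim⟩ := (isCompact_closedBall _ _).tendsto_subseq hbound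
  refine ⟨t, map_add_eq_of_forall_exists_lpSize_lt hp t fun δ hδ => ?_⟩
  have hlim₁ : Tendsto (fun k => (((φ k : ℕ) : ℝ≥0∞) + 1)⁻¹) atTop (𝓝 0) := by
    have : Tendsto (fun k : ℕ => ((k : ℝ≥0∞) + 1)⁻¹) atTop (𝓝 0) := by
      simpa using (tendsto_add_atTop_iff_nat 1).2 ENNReal.tendsto_inv_nat_nhds_zero
    exact this.comp hφ.tendsto_atTop
  have hlim₂ : Tendsto (fun k => ENNReal.ofReal (pNorm p (t - s (φ k)))) atTop (𝓝 0) := by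
    have hc : Continuous fun x : Fin n → ℝ => ENNReal.ofReal (pNorm p (t - x)) :=
      ENNReal.continuous_ofReal.comp
        ((continuous_pNorm hp).comp (continuous_const.sub continuous_id))
    have := (hc.tendsto t).comp hlim
    rwa [sub_self, pNorm_zero hp, ENNReal.ofReal_zero] at this
  have hsum := hlim₁.add hlim₂
  rw [add_zero] at hsum
  obtain ⟨k, hk⟩ := (hsum.eventually_lt_const hδ).exists
  have := isProbabilityMeasure_of_mem_couplings (hγ (φ k))
  refine ⟨γ (φ k), hγ (φ k), lt_of_le_of_lt ?_ hk⟩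
  -- Replacing `s (φ k)` by `t` costs at most the `p`-norm of their difference.
  rw [← lpSize_const hp (μ := γ (φ k))]
  calc lpSize p (fun z => z.1 + t - z.2) (γ (φ k))
      = lpSize p (fun z => (z.1 + s (φ k) - z.2) + (t - s (φ k))) (γ (φ k)) := by
        congr 1; funext z; abel
    _ ≤ _ := (lpSize_add_le hp (by fun_prop) (by fun_prop)).trans
        (add_le_add_left (hlt (φ k)).le _)

lemma RW_self (hp : 1 ≤ p) (μ : PP p n) : RW p μ μ = 0 :=
  RW_eq_zero_of_map hp (s := 0) (by simp)

lemma RW_congr (hp : 1 ≤ p) {μ μ' ν ν' : PP p n} (hμ : RW p μ μ' = 0) (hν : RW p ν ν' = 0) :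
    RW p μ ν = RW p μ' ν' := by
  apply le_antisymm
  · refine (RW_triangle hp μ μ' ν).trans ?_
    rw [hμ, zero_add]
    refine (RW_triangle hp μ' ν' ν).trans ?_
    rw [RW_comm hp ν' ν, hν, add_zero]
  · refine (RW_triangle hp μ' μ ν').trans ?_
    rw [RW_comm hp μ' μ, hμ, zero_add]
    refine (RW_triangle hp μ ν ν').trans ?_
    rw [hν, add_zero]

lemma RW_toReal_triangle (hp : 1 ≤ p) (μ ν ρ : PP p n) :
    (RW p μ ρ).toReal ≤ (RW p μ ν).toReal + (RW p ν ρ).toReal :=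
  ENNReal.toReal_le_add (RW_triangle hp μ ν ρ) (RW_ne_top hp _ _) (RW_ne_top hp _ _)

/-- `RW_p` as a pseudometric on `𝒫_p(ℝⁿ)`. -/
@[reducible] noncomputable def pseudoMetricSpacePP (hp : 1 ≤ p) (n : ℕ) :
    PseudoMetricSpace (PP p n) where
  dist μ ν := (RW p μ ν).toReal
  dist_self μ := by simp [RW_self hp]
  dist_comm μ ν := by rw [RW_comm hp]
  dist_triangle := RW_toReal_triangle hp

/-- `RW_p` as a metric on the translation classes of `𝒫_p(ℝⁿ)`. -/
@[reducible] noncomputable def metricSpaceQuotient (hp : 1 ≤ p) (n : ℕ) :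
    MetricSpace (Quotient (transSetoid p n)) where
  dist := Quotient.lift₂ (fun μ ν => (RW p μ ν).toReal) fun μ ν μ' ν' hμ hν => by
    obtain ⟨s, hs⟩ := hμ
    obtain ⟨t, ht⟩ := hν
    rw [RW_congr hp (RW_eq_zero_of_map hp hs) (RW_eq_zero_of_map hp ht)]
  dist_self a := by
    induction a using Quotient.inductionOn
    simp [RW_self hp]
  dist_comm a b := by
    induction a, b using Quotient.inductionOn₂
    simp only [Quotient.lift_mk]
    rw [RW_comm hp]
  dist_triangle a b c := by
    induction a, b, c using Quotient.inductionOn₃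
    exact RW_toReal_triangle hp _ _ _
  eq_of_dist_eq_zero {a b} h := by
    induction a, b using Quotient.inductionOn₂ with
    | _ μ ν =>
      refine Quotient.sound (exists_map_of_RW_eq_zero hp ?_)
      exact ((ENNReal.toReal_eq_zero_iff _).1 h).resolve_right (RW_ne_top hp _ _)

/-- The Dirac mass at `a` as an element of `𝒫_p(ℝⁿ)`. -/
noncomputable def diracPP (p : ℝ) {n : ℕ} (a : Fin n → ℝ) : PP p n :=
  ⟨Measure.dirac a, inferInstance, by rw [lintegral_dirac]; exact ENNReal.ofReal_lt_top⟩

lemma RW_diracPP (hp : 1 ≤ p) (a b : Fin n → ℝ) : RW p (diracPP p a) (diracPP p b) = 0 :=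
  RW_eq_zero_of_map hp (s := b - a) (by
    simp only [diracPP]
    rw [Measure.map_dirac' (by fun_prop), add_sub_cancel])

lemma diracPP_injective : Function.Injective (diracPP p : (Fin n → ℝ) → PP p n) := fun _ _ h =>
  dirac_eq_dirac_iff.1 (congrArg Subtype.val h)

end RW

end RelTransWasserstein

/-- For real `p ≥ 1`: (1) `RW_p` is finite and induces a metric on `𝒫_p(ℝⁿ)/∼`;
(2) it is a pseudometric on `𝒫_p(ℝⁿ)`; (3) for `n ≥ 1` it is not a metric on `𝒫_p(ℝⁿ)`, since
it vanishes at some pair of distinct measures. -/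
theorem theorem2 (p : ℝ) (hp : 1 ≤ p) (n : ℕ) :
    (∃ d : MetricSpace (Quotient (RelTransWasserstein.transSetoid p n)),
      ∀ μ ν : RelTransWasserstein.PP p n,
        RelTransWasserstein.RW p μ ν =
          ENNReal.ofReal (d.dist (Quotient.mk _ μ) (Quotient.mk _ ν))) ∧
    (∃ d : PseudoMetricSpace (RelTransWasserstein.PP p n),
      ∀ μ ν : RelTransWasserstein.PP p n,
        RelTransWasserstein.RW p μ ν = ENNReal.ofReal (d.dist μ ν)) ∧
    (1 ≤ n → ∃ μ ν : RelTransWasserstein.PP p n,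
      μ ≠ ν ∧ RelTransWasserstein.RW p μ ν = 0) := by
  refine ⟨⟨RelTransWasserstein.metricSpaceQuotient hp n, fun μ ν =>
      (ENNReal.ofReal_toReal (RelTransWasserstein.RW_ne_top hp μ ν)).symm⟩,
    ⟨RelTransWasserstein.pseudoMetricSpacePP hp n, fun μ ν =>
      (ENNReal.ofReal_toReal (RelTransWasserstein.RW_ne_top hp μ ν)).symm⟩, fun hn => ?_⟩
  refine ⟨RelTransWasserstein.diracPP p 0, RelTransWasserstein.diracPP p 1, fun h => ?_,
    RelTransWasserstein.RW_diracPP hp 0 1⟩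
  -- A coordinate exists because `1 ≤ n`, so the points `0` and `1` differ.
  exact zero_ne_one (congrFun (RelTransWasserstein.diracPP_injective h) ⟨0, hn⟩)
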